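/- Let $q$ be a prime power, let $V$ be a finite-dimensional vector space over $\mathbb{F}_q$, and let $\mathcal{Q}$ be a finite classical polar space of rank $r\ge 1$ with ambient space $V$. That is, $V$ carries a non-degenerate alternating, Hermitian or quadratic form, the subspaces of $\mathcal{Q}$ are the totally isotropic (for a quadratic form: totally singular) subspaces of $V$, and $r$ is the largest dimension of a subspace of $\mathcal{Q}$; all dimensions are vector space dimensions. The type $Q$ of $\mathcal{Q}$ and its parameter $\epsilon$ are determined by the kind of form and by $n=\dim V$: - alternating: $\mathrm{Sp}(q)$, with $n=2r$, $\epsilon=0$; - Hermitian ($q$ a square): $U^+(q)$, with $n=2r$, $\epsilon=-\tfrac12$, or $U^-(q)$, with $n=2r+1$, $\epsilon=\tfrac12$; - quadratic: $\Omega^+(q)$, with $n=2r$, $\epsilon=-1$; or $\Omega(q)$, with $n=2r+1$, $\epsilon=0$; or $\Omega^-(q)$, with $n=2r+2$, $\epsilon=1$. A $t$-$(r,k,\lambda)_Q$ design is a set $D$ of $k$-dimensional subspaces of $\mathcal{Q}$ (called blocks) such that every $t$-dimensional subspace of $\mathcal{Q}$ is contained in exactly $\lambda$ elements of $D$. A hyperplane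 $H$ of $V$ is non-degenerate if the restriction of the form to $H$ is non-degenerate. Write $[m]_q = \frac{q^m-1}{q-1}$. **Theorem.** Let $1\le t\le k\le r$, let $D$ be a $t$-$(r,k,\lambda)_Q$ design in $\mathcal{Q}$, and let $H$ be a non-degenerate hyperplane of $V$. Then the restriction of $\mathcal{Q}$ to $H$ is a classical polar space $\mathcal{Q}'$ with ambient space $H$, of some rank $r'\in\{r,r-1\}$ and some type $Q'$ (here rank $0$ is allowed), and $$\mathrm{Res}_H(D)=\{B\in D \mid B\subseteq H\}$$ is a $(t-1)$-$(r',k,\lambda')_{Q'}$ design in $\mathcal{Q}'$ with $$\lambda'=\begin{cases}\dfrac{[r-t+1]_q\,(q^{\,r-k+\epsilon}+1)}{[k-t+1]_q}\;\lambda & \text{if } r'=r,\\[3mm] \dfrac{(q^{\,r-t+1+\epsilon}+1)\,[r-k]_q}{[k-t+1]_q}\;\lambda & \text{if } r'=r-1.\end{cases}$$ In the case $k=r$, $r'=r-1$, where $\mathcal{Q}'$ has no $k$-dimensional subspace, this means that $\mathrm{Res}_H(D)$ is empty and $\lambda'=0$. -/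

import Mathlib

namespace PolarDesign

/-- The forms defining the finite classical polar spaces on the ambient vector space `V`:
alternating bilinear forms, Hermitian forms with respect to a field automorphism of order two
(which forces the order of a finite field to be a square), and quadratic forms.
Non-degeneracy is a separate predicate, since a form may become degenerate on a subspace. -/
inductive ClassicalForm (K V : Type*) [Field K] [AddCommGroup V] [Module K V] where
  | alternating (B : LinearMap.BilinForm K V) (alt : B.IsAlt)
  | hermitian (σ : K →+* K) (invol : ∀ a, σ (σ a) = a) (nontriv : σ ≠ RingHom.id K)
      (h : V →ₛₗ[σ] V →ₗ[K] K) (symm : ∀ x y, σ (h x y) = h y x)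
  | quadratic (f : QuadraticForm K V)

/-- The six types of finite classical polar spaces, in the order
`Sp(q)`, `U⁺(q)`, `U⁻(q)`, `Ω⁺(q)`, `Ω(q)`, `Ω⁻(q)`
(the field, and hence `q`, is kept separately). -/
inductive PolarType where
  | symplectic
  | hermitianPlus
  | hermitianMinus
  | hyperbolic
  | parabolic
  | elliptic

/-- The parameter `ε` of a type. -/
noncomputable def PolarType.eps : PolarType → ℝ
  | .symplectic => 0
  | .hermitianPlus => -1 / 2
  | .hermitianMinus => 1 / 2
  | .hyperbolic => -1
  | .parabolic => 0
  | .elliptic => 1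

/-- The `q`-analog `[n]_q = (q ^ n - 1) / (q - 1) = 1 + q + ⋯ + q ^ (n - 1)` of `n`. -/
def qNumber (q n : ℕ) : ℕ := ∑ i ∈ Finset.range n, q ^ i

variable {K V : Type*} [Field K] [AddCommGroup V] [Module K V]

namespace ClassicalForm

/-- Non-degeneracy. For a quadratic form this is non-degeneracy in every characteristic: over a
finite field it means that no nonzero singular vector is orthogonal to all of `V`. -/
def Nondegenerate : ClassicalForm K V → Prop
  | alternating B _ => B.Nondegenerate
  | hermitian _ _ _ h _ => LinearMap.Nondegenerate h
  | quadratic f => QuadraticMap.Nondegenerate (Q := f)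

/-- `U` is a subspace of the polar space: totally isotropic for an alternating or Hermitian form,
totally singular for a quadratic form. -/
def IsSubspace : ClassicalForm K V → Submodule K V → Prop
  | alternating B _, U => ∀ x ∈ U, ∀ y ∈ U, B x y = 0
  | hermitian _ _ _ h _, U => ∀ x ∈ U, ∀ y ∈ U, h x y = 0
  | quadratic f, U => ∀ x ∈ U, f x = 0

/-- The restriction of the form to a subspace `H` of `V`. -/
def restrict : ClassicalForm K V → (H : Submodule K V) → ClassicalForm K H
  | alternating B alt, H => alternating (B.domRestrict₁₂ H H) fun x => alt x
  | hermitian σ invol nontriv h symm, H =>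
      hermitian σ invol nontriv (h.domRestrict₁₂ H H) fun x y => symm x y
  | quadratic f, H => quadratic (f.comp H.subtype)

/-- The rank of the polar space is the largest dimension of one of its subspaces. -/
def HasRank (F : ClassicalForm K V) (r : ℕ) : Prop :=
  IsGreatest {d : ℕ | ∃ U : Submodule K V, F.IsSubspace U ∧ Module.finrank K U = d} r

/-- The kind of form and the dimension of the ambient space agree with those of
the polar space of the given type and of rank `r`. -/
def HasType : ClassicalForm K V → PolarType → ℕ → Prop
  | alternating _ _, .symplectic, r => Module.finrank K V = 2 * r
  | hermitian _ _ _ _ _, .hermitianPlus, r => Module.finrank K V = 2 * r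
  | hermitian _ _ _ _ _, .hermitianMinus, r => Module.finrank K V = 2 * r + 1
  | quadratic _, .hyperbolic, r => Module.finrank K V = 2 * r
  | quadratic _, .parabolic, r => Module.finrank K V = 2 * r + 1
  | quadratic _, .elliptic, r => Module.finrank K V = 2 * r + 2
  | _, _, _ => False

/-- The form defines a classical polar space of type `Q` and rank `r` with ambient space `V`. -/
structure IsPolarSpace (F : ClassicalForm K V) (Q : PolarType) (r : ℕ) : Prop where
  nondegenerate : F.Nondegenerate
  rank : F.HasRank r
  type : F.HasType Q r

/-- `D` is a `t`-`(r, k, l)_Q` design in the polar space defined by `F`. No relation between the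
numbers `t`, `k`, `r` is built in; the usual ranges are to be stated where they are needed. -/
structure IsDesign (F : ClassicalForm K V) (Q : PolarType) (t r k l : ℕ)
    (D : Set (Submodule K V)) : Prop where
  ambient : F.IsPolarSpace Q r
  blocks : ∀ B ∈ D, F.IsSubspace B ∧ Module.finrank K B = k
  regular : ∀ T : Submodule K V, F.IsSubspace T → Module.finrank K T = t →
    {B ∈ D | T ≤ B}.ncard = l

/-- `H` is a non-degenerate hyperplane of `V`: it has codimension one, and the form restricted
to it is non-degenerate. -/
structure IsNondegenerateHyperplane (F : ClassicalForm K V) (H : Submodule K V) : Prop where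
  hyperplane : Module.finrank K H + 1 = Module.finrank K V
  nondegenerate : (F.restrict H).Nondegenerate

end ClassicalForm

/-- The members of `D` that are contained in `H`, regarded as subspaces of `H`. -/
def residual (D : Set (Submodule K V)) (H : Submodule K V) : Set (Submodule K H) :=
  {B | B.map H.subtype ∈ D}

end PolarDesign

/-!
Let `T` be a `(t - 1)`-dimensional subspace of the polar space that lies in the hyperplane `H`, and
let `q` be the order of the field. A singular vector `x` orthogonal to `T` and not in `T` extends
`T` to a `t`-dimensional subspace, which lies in `l` blocks. Counting the pairs of such a vector `x`
and a block `B` with `T ≤ B` and `x ∈ B` gives the number of blocks through `T`; counting only the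
pairs with `x ∉ H` gives the number of those that are not in `H`, since each of them has
`q ^ k - q ^ (k - 1)` vectors outside `H` (`IsDesign.ncard_isSingular_mul`). The difference is the
number of blocks through `T` in `H`. So it remains to count the singular vectors orthogonal to `T`,
in `V` and in `H`.

This count (`ncard_isSingular_perp`) is uniform in the three kinds of forms. Let `n = dim V`, and
let `s` be `1`, `√q` or `q` for an alternating, Hermitian or quadratic form. If `U` is a subspace of
the polar space and `x` is not orthogonal to `U`, then one in `s` of the vectors of the coset
`x + U` is singular. All maximal subspaces have the same dimension `r`, so `T` is contained in some
`r`-dimensional `U`. The singular vectors of `T^⊥ ∖ U^⊥` are counted by cosets of `U`, and the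
singular vectors of `U^⊥` are those of `U`. Since `q ^ (n - r) / s = q ^ (r + ε)`
(`HasType.index_mul_rpow`), the result is expressed by `r` and `ε`.

The rank of the restriction to `H` is `r` or `r - 1` because every subspace of `V` loses at most one
dimension on intersection with `H`. That a non-degenerate form is of one of the six types
(`exists_isPolarSpace`) means that the anisotropic part of a quadratic form has dimension at most
two, by the Chevalley–Warning theorem, and that of a Hermitian form at most one, by the surjectivity
of the norm.
-/

namespace PolarDesign

/-! ### Finite fields with an involution -/

section Involution

variable {K : Type*} [Field K] {σ : K →+* K}

/-- For endomorphisms of a finite group whose two compositions are trivial, exactness in one order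
implies exactness in the other, by comparing orders. -/
theorem range_eq_ker_of_range_eq_ker {G : Type*} [Group G] [Finite G] {f g : G →* G}
    (h : g.range = f.ker) (hle : f.range ≤ g.ker) : f.range = g.ker := by
  refine Subgroup.eq_of_le_of_card_ge hle ?_
  have h1 := f.ker.card_mul_index
  have h2 := g.ker.card_mul_index
  rw [Subgroup.index_ker] at h1 h2
  rw [h, mul_comm, ← h1] at h2
  exact (Nat.eq_of_mul_eq_mul_left Nat.card_pos h2).le

theorem exists_ne_of_ne_id (hσ : σ ≠ RingHom.id K) : ∃ c, σ c ≠ c := by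
  by_contra! h
  exact hσ (RingHom.ext h)

/-- Surjectivity of the norm onto the fixed field. Hilbert's Theorem 90 says that the kernel of the
norm is the range of `a ↦ a / σ a`, so on the finite unit group the range of the norm is the kernel
of `a ↦ a / σ a`. -/
theorem exists_mul_conj_eq [Finite K] (invol : ∀ a, σ (σ a) = a) (hσ : σ ≠ RingHom.id K) {c : K}
    (hc : σ c = c) (hc0 : c ≠ 0) : ∃ a, a * σ a = c := by
  let s : Kˣ →* Kˣ := Units.map σ
  have hss : ∀ a, s (s a) = a := fun a => Units.ext (invol a)
  let f : Kˣ →* Kˣ := MonoidHom.id _ * s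
  let g : Kˣ →* Kˣ := MonoidHom.id _ / s
  have hfg : g.range = f.ker := by
    ext a
    constructor
    · rintro ⟨b, rfl⟩
      simp [f, g, MonoidHom.mem_ker, hss]
    · intro ha
      have ha' : (a : K) * σ a = 1 := congrArg Units.val ha
      -- The Hilbert 90 witness is `d + a * σ d`, nonzero for a suitable `d`.
      have key : ∃ d : K, d + a * σ d ≠ 0 := by
        by_contra! h
        have h1 : 1 + (a : K) = 0 := by simpa using h 1
        obtain ⟨d, hd⟩ := exists_ne_of_ne_id hσ
        apply hd
        linear_combination σ d * h1 - h d
      obtain ⟨d, hd⟩ := key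
      refine ⟨Units.mk0 _ hd, ?_⟩
      change Units.mk0 _ hd / s (Units.mk0 _ hd) = a
      rw [div_eq_iff_eq_mul]
      ext
      simp only [Units.val_mk0, Units.val_mul, s, Units.coe_map, MonoidHom.coe_coe, map_add,
        map_mul, invol]
      linear_combination (-d) * ha'
  have hgf : f.range ≤ g.ker := by
    rintro _ ⟨b, rfl⟩
    simp [f, g, MonoidHom.mem_ker, hss, mul_comm]
  have := range_eq_ker_of_range_eq_ker hfg hgf
  have hmem : Units.mk0 c hc0 ∈ g.ker := by
    rw [MonoidHom.mem_ker]
    change Units.mk0 c hc0 / s (Units.mk0 c hc0) = 1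
    rw [div_eq_one]
    ext
    simp [s, hc]
  rw [← this] at hmem
  obtain ⟨a, ha⟩ := hmem
  exact ⟨a, congrArg Units.val ha⟩

theorem exists_add_conj_ne_zero (hσ : σ ≠ RingHom.id K) : ∃ c, c + σ c ≠ 0 := by
  by_contra! h
  obtain ⟨c, hc⟩ := exists_ne_of_ne_id hσ
  have h1 : (1 : K) + 1 = 0 := by simpa using h 1
  apply hc
  linear_combination h c - c * h1

/-- Surjectivity of the trace onto the fixed field. -/
theorem exists_add_conj_eq (invol : ∀ a, σ (σ a) = a) (hσ : σ ≠ RingHom.id K) {c : K}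
    (hc : σ c = c) : ∃ a, a + σ a = c := by
  obtain ⟨d, hd⟩ := exists_add_conj_ne_zero hσ
  refine ⟨c / (d + σ d) * d, ?_⟩
  have : σ d + d ≠ 0 := by rwa [add_comm]
  simp only [map_mul, map_div₀, map_add, invol, hc]
  field_simp
  ring

/-- A nonzero element of trace zero identifies the trace-zero elements with the fixed field. -/
theorem ncard_conj_eq_neg (hσ : σ ≠ RingHom.id K) (invol : ∀ a, σ (σ a) = a) :
    {a | a + σ a = 0}.ncard = {a | σ a = a}.ncard := by
  obtain ⟨c, hc⟩ := exists_ne_of_ne_id hσ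
  set e := c - σ c with he
  have he0 : e ≠ 0 := sub_ne_zero.mpr (Ne.symm hc)
  have hσe : σ e = - e := by simp [he, invol]
  symm
  refine Set.ncard_congr (fun a _ => e * a) ?_ ?_ ?_
  · intro a ha
    simp only [Set.mem_ofPred_eq] at ha ⊢
    rw [map_mul, hσe, ha]; ring
  · intro a b _ _ h
    exact mul_left_cancel₀ he0 h
  · intro b hb
    refine ⟨b / e, ?_, by field_simp⟩
    simp only [Set.mem_ofPred_eq] at hb ⊢
    rw [map_div₀, hσe, eq_neg_of_add_eq_zero_right hb, neg_div_neg_eq]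

/-- The fixed field of an involution has index two. -/
theorem ncard_fixed_sq [Finite K] (invol : ∀ a, σ (σ a) = a) (hσ : σ ≠ RingHom.id K) :
    {a | σ a = a}.ncard * {a | σ a = a}.ncard = Nat.card K := by
  let f : K →+ K := AddMonoidHom.id K + σ
  have h1 := f.ker.card_mul_index
  rw [AddSubgroup.index_ker] at h1
  have hk : Nat.card f.ker = {a | σ a = a}.ncard := ncard_conj_eq_neg hσ invol
  have hr : (f.range : Set K) = {a | σ a = a} := by
    ext c
    constructor
    · rintro ⟨a, rfl⟩
      simp [f, invol, add_comm]
    · intro hc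
      obtain ⟨a, ha⟩ := exists_add_conj_eq invol hσ hc
      exact ⟨a, ha⟩
  have hr' : Nat.card f.range = {a | σ a = a}.ncard := by rw [← hr]; rfl
  rwa [hk, hr'] at h1

theorem ncard_add_conj_eq (invol : ∀ a, σ (σ a) = a) (hσ : σ ≠ RingHom.id K) {c : K}
    (hc : σ c = c) : {a | a + σ a = c}.ncard = {a | σ a = a}.ncard := by
  obtain ⟨d, hd⟩ := exists_add_conj_eq invol hσ hc
  rw [← ncard_conj_eq_neg hσ invol]
  refine Set.ncard_congr (fun a _ => a - d) ?_ ?_ ?_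
  · intro a ha
    simp only [Set.mem_ofPred_eq, map_sub] at ha ⊢
    linear_combination ha - hd
  · intro a b _ _ h
    simpa using h
  · intro b hb
    refine ⟨b + d, ?_, by simp⟩
    simp only [Set.mem_ofPred_eq, map_add] at hb ⊢
    linear_combination hb + hd

end Involution

variable {K V : Type*} [Field K] [AddCommGroup V] [Module K V]

namespace ClassicalForm

/-! ### Singular vectors and the polarity -/

/-- The field automorphism with respect to which the form is sesquilinear. -/
def conj : ClassicalForm K V → K →+* K
  | alternating _ _ => RingHom.id K
  | hermitian σ _ _ _ _ => σ
  | quadratic _ => RingHom.id K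

/-- The reflexive sesquilinear form that defines orthogonality; for a quadratic form this is its
polar form. -/
def sesq : (F : ClassicalForm K V) → V →ₛₗ[F.conj] V →ₗ[K] K
  | alternating B _ => B
  | hermitian _ _ _ h _ => h
  | quadratic f => f.polarBilin

/-- The vectors spanning subspaces of the polar space, and the zero vector. -/
def IsSingular : ClassicalForm K V → V → Prop
  | alternating _ _, _ => True
  | hermitian _ _ _ h _, x => h x x = 0
  | quadratic f, x => f x = 0

/-- The number of values that the form can take on the diagonal: for `x` not orthogonal to a
subspace `U` of the polar space, one in `F.index` of the vectors of `x + U` is singular. -/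
noncomputable def index : ClassicalForm K V → ℕ
  | alternating _ _ => 1
  | hermitian σ _ _ _ _ => {a | σ a = a}.ncard
  | quadratic _ => Nat.card K

theorem conj_surjective (F : ClassicalForm K V) : Function.Surjective F.conj := by
  cases F with
  | alternating B alt => exact Function.surjective_id
  | hermitian σ invol nontriv h symm => exact fun a => ⟨σ a, invol a⟩
  | quadratic f => exact Function.surjective_id

theorem sesq_eq_zero_comm (F : ClassicalForm K V) {x y : V} (hxy : F.sesq x y = 0) :
    F.sesq y x = 0 := by
  cases F with
  | alternating B alt => exact alt.isRefl x y hxy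
  | hermitian σ invol nontriv h symm =>
    change h y x = 0
    rw [← symm, show h x y = 0 from hxy, map_zero]
  | quadratic f =>
    change QuadraticMap.polar f y x = 0
    rw [QuadraticMap.polar_comm]
    exact hxy

theorem isSingular_zero (F : ClassicalForm K V) : F.IsSingular 0 := by
  cases F with
  | alternating B alt => trivial
  | hermitian σ invol nontriv h symm => simp [IsSingular]
  | quadratic f => simp [IsSingular]

theorem IsSingular.smul {F : ClassicalForm K V} {x : V} (hx : F.IsSingular x) (a : K) :
    F.IsSingular (a • x) := by
  cases F with
  | alternating B alt => trivial
  | hermitian σ invol nontriv h symm =>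
    have hx : h x x = 0 := hx
    simp [IsSingular, hx]
  | quadratic f =>
    have hx : f x = 0 := hx
    simp [IsSingular, QuadraticMap.map_smul, hx]

/-- Whether `x + u` is singular, for singular `u`, depends only on the product of `x` and `u`, and
the set of admissible products has a size that is independent of `x`. -/
theorem exists_isSingular_add_iff [Finite K] (F : ClassicalForm K V) (x : V) :
    ∃ A : Set K, A.ncard * F.index = Nat.card K ∧
      ∀ u, F.IsSingular u → (F.IsSingular (x + u) ↔ F.sesq x u ∈ A) := by
  cases F with
  | alternating B alt =>
    exact ⟨Set.univ, by simp [index], by simp [IsSingular]⟩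
  | hermitian σ invol nontriv h symm =>
    refine ⟨{c | c + σ c = - h x x}, ?_, ?_⟩
    · rw [ncard_add_conj_eq invol nontriv (by simp [symm])]
      exact ncard_fixed_sq invol nontriv
    · intro u hu
      have hu : h u u = 0 := hu
      change h (x + u) (x + u) = 0 ↔ h x u + σ (h x u) = - h x x
      simp only [map_add, LinearMap.add_apply, hu, symm]
      rw [eq_neg_iff_add_eq_zero]
      apply Eq.congr_left
      ring
  | quadratic f =>
    refine ⟨{- f x}, by simp [index], ?_⟩
    intro u hu
    have hu : f u = 0 := hu
    change f (x + u) = 0 ↔ QuadraticMap.polar f x u = - f x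
    rw [QuadraticMap.polar, hu, eq_neg_iff_add_eq_zero]
    simp

theorem index_pos [Finite K] (F : ClassicalForm K V) : 0 < F.index := by
  obtain ⟨A, hA, -⟩ := F.exists_isSingular_add_iff 0
  exact Nat.pos_of_mul_pos_left (hA ▸ Nat.card_pos)

theorem IsSingular.add {F : ClassicalForm K V} {x y : V} (hx : F.IsSingular x)
    (hy : F.IsSingular y) (hxy : F.sesq x y = 0) : F.IsSingular (x + y) := by
  cases F with
  | alternating B alt => trivial
  | hermitian σ invol nontriv h symm =>
    have hx : h x x = 0 := hx
    have hy : h y y = 0 := hy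
    have hxy : h x y = 0 := hxy
    simp [IsSingular, hx, hy, hxy, ← symm x y]
  | quadratic f =>
    have hx : f x = 0 := hx
    have hy : f y = 0 := hy
    have hxy : QuadraticMap.polar f x y = 0 := hxy
    change f (x + y) = 0
    simpa [QuadraticMap.polar, hx, hy] using hxy

/-- Only the singular part of the radical is trivial in general: the polar form of a parabolic
quadric in characteristic two has a one-dimensional radical. -/
theorem Nondegenerate.eq_zero {F : ClassicalForm K V} (hF : F.Nondegenerate) {x : V}
    (hx : F.IsSingular x) (h : F.sesq x = 0) : x = 0 := by
  cases F with
  | alternating B alt => exact hF.1 x fun y => LinearMap.congr_fun h y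
  | hermitian σ invol nontriv b symm => exact hF.1 x fun y => LinearMap.congr_fun h y
  | quadratic f =>
    have : x ∈ f.radical := ⟨hx, h⟩
    rwa [QuadraticMap.Nondegenerate.radical_eq_bot hF] at this

/-- The orthogonal space of `U`. -/
def perp (F : ClassicalForm K V) (U : Submodule K V) : Submodule K V where
  carrier := {y | ∀ x ∈ U, F.sesq x y = 0}
  add_mem' ha hb x hx := by rw [map_add, ha x hx, hb x hx, add_zero]
  zero_mem' x _ := map_zero _
  smul_mem' c y hy x hx := by rw [map_smul, hy x hx, smul_zero]

theorem mem_perp {F : ClassicalForm K V} {U : Submodule K V} {y : V} :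
    y ∈ F.perp U ↔ ∀ x ∈ U, F.sesq x y = 0 := Iff.rfl

theorem mem_perp' {F : ClassicalForm K V} {U : Submodule K V} {y : V} :
    y ∈ F.perp U ↔ ∀ x ∈ U, F.sesq y x = 0 :=
  ⟨fun h x hx => F.sesq_eq_zero_comm (h x hx), fun h x hx => F.sesq_eq_zero_comm (h x hx)⟩

theorem perp_anti (F : ClassicalForm K V) {U W : Submodule K V} (h : U ≤ W) :
    F.perp W ≤ F.perp U := fun _ hy x hx => hy x (h hx)

theorem isSubspace_iff {F : ClassicalForm K V} {U : Submodule K V} :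
    F.IsSubspace U ↔ (∀ x ∈ U, F.IsSingular x) ∧ U ≤ F.perp U := by
  cases F with
  | alternating B alt =>
    exact ⟨fun h => ⟨fun _ _ => trivial, fun y hy x hx => h x hx y hy⟩,
      fun h x hx y hy => h.2 hy x hx⟩
  | hermitian σ invol nontriv b symm =>
    exact ⟨fun h => ⟨fun x hx => h x hx x hx, fun y hy x hx => h x hx y hy⟩,
      fun h x hx y hy => h.2 hy x hx⟩
  | quadratic f =>
    refine ⟨fun h => ⟨h, fun y hy x hx => ?_⟩, fun h => h.1⟩
    change QuadraticMap.polar f x y = 0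
    rw [QuadraticMap.polar, h _ (U.add_mem hx hy), h x hx, h y hy]
    simp

theorem IsSubspace.mono {F : ClassicalForm K V} {U W : Submodule K V} (hW : F.IsSubspace W)
    (h : U ≤ W) : F.IsSubspace U := by
  rw [isSubspace_iff] at hW ⊢
  exact ⟨fun x hx => hW.1 x (h hx), h.trans (hW.2.trans (F.perp_anti h))⟩

theorem isSubspace_bot (F : ClassicalForm K V) : F.IsSubspace ⊥ := by
  rw [isSubspace_iff]
  refine ⟨fun x hx => ?_, bot_le⟩
  rw [(Submodule.mem_bot K).mp hx]
  exact F.isSingular_zero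

theorem IsSubspace.sup_span {F : ClassicalForm K V} {U : Submodule K V} (hU : F.IsSubspace U)
    {x : V} (hx : F.IsSingular x) (hxU : x ∈ F.perp U) :
    F.IsSubspace (U ⊔ Submodule.span K {x}) := by
  rw [isSubspace_iff] at hU ⊢
  have hxx : F.sesq x x = 0 := by
    cases F with
    | alternating B alt => exact alt x
    | hermitian σ invol nontriv b symm => exact hx
    | quadratic f =>
      have hx : f x = 0 := hx
      change QuadraticMap.polar f x x = 0
      simp [hx]
  constructor
  · intro y hy
    obtain ⟨u, hu, _, h', rfl⟩ := Submodule.mem_sup.mp hy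
    obtain ⟨a, rfl⟩ := Submodule.mem_span_singleton.mp h'
    refine (hU.1 u hu).add (hx.smul a) ?_
    rw [map_smul, hxU u hu, smul_zero]
  · intro y hy z hz
    obtain ⟨u, hu, _, h', rfl⟩ := Submodule.mem_sup.mp hy
    obtain ⟨a, rfl⟩ := Submodule.mem_span_singleton.mp h'
    obtain ⟨v, hv, _, h', rfl⟩ := Submodule.mem_sup.mp hz
    obtain ⟨b, rfl⟩ := Submodule.mem_span_singleton.mp h'
    simp [hU.2 hu v hv, hxU v hv, mem_perp'.mp hxU u hu, hxx]

end ClassicalForm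

/-! ### Counting lemmas -/

/-- Double counting of the pairs of a relation between finite sets. -/
theorem ncard_mul_eq_ncard_mul {α β : Type*} [Finite α] [Finite β] (X : Set α) (Y : Set β)
    (R : α → β → Prop) (m n : ℕ) (hX : ∀ x ∈ X, {y ∈ Y | R x y}.ncard = m)
    (hY : ∀ y ∈ Y, {x ∈ X | R x y}.ncard = n) : X.ncard * m = Y.ncard * n := by
  classical
  have := Fintype.ofFinite α
  have := Fintype.ofFinite β
  rw [Set.ncard_eq_toFinset_card', Set.ncard_eq_toFinset_card']
  refine Finset.card_mul_eq_card_mul R (fun x hx => ?_) fun y hy => ?_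
  · rw [← hX x (by simpa using hx), Set.ncard_eq_toFinset_card']
    congr 1
    ext y
    simp [Finset.mem_bipartiteAbove]
  · rw [← hY y (by simpa using hy), Set.ncard_eq_toFinset_card']
    congr 1
    ext y
    simp [Finset.mem_bipartiteBelow]

/-- The preimage of `A` under a nonzero linear functional has the same density as `A`. -/
theorem ncard_preimage_mul_card [Finite K] [Finite V] {φ : V →ₗ[K] K} (hφ : φ ≠ 0) (A : Set K) :
    (φ ⁻¹' A).ncard * Nat.card K = A.ncard * Nat.card V := by
  obtain ⟨v, hv⟩ : ∃ v, φ v ≠ 0 := by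
    by_contra! h
    exact hφ (LinearMap.ext h)
  set w := (φ v)⁻¹ • v with hw
  have hw1 : φ w = 1 := by simp [hw, hv]
  rw [← Nat.card_coe_set_eq, ← Nat.card_coe_set_eq, ← Nat.card_prod, ← Nat.card_prod]
  refine Nat.card_congr
    { toFun := fun p => (⟨φ p.1, p.1.2⟩, p.1 + (p.2 - φ p.1) • w)
      invFun := fun p => (⟨p.2 + ((p.1 : K) - φ p.2) • w, by simp [hw1]⟩, φ p.2)
      left_inv := fun p => ?_
      right_inv := fun p => ?_ }
  · ext
    · simp only [map_add, map_smul, hw1, smul_eq_mul, mul_one]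
      module
    · simp [hw1]
  · ext
    · simp [hw1]
    · simp only [map_add, map_smul, hw1, smul_eq_mul, mul_one]
      module

theorem ncard_submodule [FiniteDimensional K V] (U : Submodule K V) :
    (U : Set V).ncard = Nat.card K ^ Module.finrank K U := by
  rw [← Module.natCard_eq_pow_finrank, ← Nat.card_coe_set_eq]
  rfl

namespace ClassicalForm

/-! ### Subspaces of the polar space and their orthogonal spaces -/

theorem sesq_injOn {F : ClassicalForm K V} (hF : F.Nondegenerate) {U : Submodule K V}
    (hU : F.IsSubspace U) : Set.InjOn F.sesq U := by
  intro x hx y hy hxy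
  rw [← sub_eq_zero]
  exact hF.eq_zero ((isSubspace_iff.mp hU).1 _ (U.sub_mem hx hy)) (by rw [map_sub, hxy, sub_self])

theorem finrank_sup_span [FiniteDimensional K V] {U : Submodule K V} {x : V} (hx : x ∉ U) :
    Module.finrank K ↥(U ⊔ Submodule.span K {x}) = Module.finrank K U + 1 := by
  have h1 := Submodule.finrank_sup_add_finrank_inf_eq U (Submodule.span K {x})
  have hx0 : x ≠ 0 := fun h => hx (h ▸ U.zero_mem)
  have h2 : U ⊓ Submodule.span K {x} = ⊥ := by
    rw [← disjoint_iff, Submodule.disjoint_span_singleton' hx0]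
    exact hx
  rw [h2, finrank_bot, finrank_span_singleton hx0] at h1
  exact h1

theorem mem_of_isSingular_of_mem_perp [FiniteDimensional K V] {F : ClassicalForm K V} {r : ℕ}
    (hr : F.HasRank r) {U : Submodule K V} (hU : F.IsSubspace U)
    (hUr : Module.finrank K U = r) {x : V}
    (hx : F.IsSingular x) (hxU : x ∈ F.perp U) : x ∈ U := by
  by_contra h
  have := hr.2 ⟨_, hU.sup_span hx hxU, finrank_sup_span h⟩
  omega

variable [Finite K] [FiniteDimensional K V]

theorem finrank_perp {F : ClassicalForm K V} (hF : F.Nondegenerate) {U : Submodule K V}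
    (hU : F.IsSubspace U) :
    Module.finrank K U + Module.finrank K (F.perp U) = Module.finrank K V := by
  have : RingHomSurjective F.conj := ⟨F.conj_surjective⟩
  let W : Submodule K (Module.Dual K V) := U.map F.sesq
  have hW : W.dualCoannihilator = F.perp U := by
    ext y
    simp only [Submodule.mem_dualCoannihilator, mem_perp, W, Submodule.mem_map]
    exact ⟨fun h x hx => h _ ⟨x, hx, rfl⟩, by rintro h _ ⟨x, hx, rfl⟩; exact h x hx⟩
  have hcard : Nat.card K ^ Module.finrank K W = Nat.card K ^ Module.finrank K U := by
    rw [← ncard_submodule, ← ncard_submodule]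
    exact (sesq_injOn hF hU).ncard_image
  rw [← Nat.pow_right_injective Finite.one_lt_card hcard, ← hW]
  exact Subspace.finrank_add_finrank_dualCoannihilator_eq W

theorem two_mul_finrank_le {F : ClassicalForm K V} (hF : F.Nondegenerate) {U : Submodule K V}
    (hU : F.IsSubspace U) : 2 * Module.finrank K U ≤ Module.finrank K V := by
  have h1 := finrank_perp hF hU
  have h2 := Submodule.finrank_mono (isSubspace_iff.mp hU).2
  omega

/-- A subspace of the polar space of smaller dimension than another one can be enlarged by a
vector of the latter. -/
theorem exists_mem_perp_of_finrank_lt {F : ClassicalForm K V} (hF : F.Nondegenerate)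
    {U W : Submodule K V} (hU : F.IsSubspace U) (hW : F.IsSubspace W)
    (h : Module.finrank K U < Module.finrank K W) : ∃ x ∈ W, x ∈ F.perp U ∧ x ∉ U := by
  by_contra! hcon
  -- `W ⊔ U^⊥` lies in `(U ⊓ W)^⊥`, which bounds the dimension of `W ⊓ U^⊥` from below.
  have h1 : W ⊔ F.perp U ≤ F.perp (U ⊓ W) :=
    sup_le ((isSubspace_iff.mp hW).2.trans (F.perp_anti inf_le_right)) (F.perp_anti inf_le_left)
  have h2 := Submodule.finrank_mono h1
  have h3 := Submodule.finrank_sup_add_finrank_inf_eq W (F.perp U)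
  have h4 := finrank_perp hF hU
  have h5 := finrank_perp hF (hU.mono (W := U) (U := U ⊓ W) inf_le_left)
  have h6 : Module.finrank K ↥(W ⊓ F.perp U) ≤ Module.finrank K ↥(U ⊓ W) :=
    Submodule.finrank_mono fun x hx => ⟨hcon x hx.1 hx.2, hx.1⟩
  omega

/-- All maximal subspaces of the polar space have the same dimension. -/
theorem exists_le_finrank_eq {F : ClassicalForm K V} (hF : F.Nondegenerate)
    {T W : Submodule K V} (hT : F.IsSubspace T) (hW : F.IsSubspace W)
    (h : Module.finrank K T ≤ Module.finrank K W) :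
    ∃ U, F.IsSubspace U ∧ T ≤ U ∧ Module.finrank K U = Module.finrank K W := by
  induction hd : Module.finrank K W - Module.finrank K T generalizing T with
  | zero => exact ⟨T, hT, le_rfl, by omega⟩
  | succ d ih =>
    obtain ⟨x, hxW, hxp, hxT⟩ := exists_mem_perp_of_finrank_lt hF hT hW (by omega)
    have hs := finrank_sup_span hxT
    obtain ⟨U, hU, hle, hfin⟩ :=
      ih (hT.sup_span ((isSubspace_iff.mp hW).1 x hxW) hxp) (by omega) (by omega)
    exact ⟨U, hU, le_sup_left.trans hle, hfin⟩

/-! ### Counting singular vectors -/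

theorem ncard_coset {F : ClassicalForm K V} {U : Submodule K V} (hU : F.IsSubspace U) {x : V}
    (hx : x ∉ F.perp U) :
    {u ∈ (U : Set V) | F.IsSingular (x + u)}.ncard * F.index = (U : Set V).ncard := by
  have := Module.finite_of_finite K (M := V)
  obtain ⟨A, hA, hAx⟩ := F.exists_isSingular_add_iff x
  let φ : U →ₗ[K] K := (F.sesq x).comp U.subtype
  have hφ : φ ≠ 0 := by
    intro h
    exact hx (mem_perp'.mpr fun u hu => LinearMap.congr_fun h ⟨u, hu⟩)
  have h1 := ncard_preimage_mul_card hφ A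
  have h2 : {u ∈ (U : Set V) | F.IsSingular (x + u)}.ncard = (φ ⁻¹' A).ncard := by
    rw [← Set.ncard_image_of_injective (φ ⁻¹' A) U.injective_subtype]
    congr 1
    ext u
    simp only [Set.mem_ofPred_eq, SetLike.mem_coe, Set.mem_image, Set.mem_preimage,
      Submodule.subtype_apply, Subtype.exists, exists_and_right, exists_eq_right]
    exact ⟨fun h => ⟨h.1, (hAx u ((isSubspace_iff.mp hU).1 u h.1)).mp h.2⟩,
      fun ⟨h, h'⟩ => ⟨h, (hAx u ((isSubspace_iff.mp hU).1 u h)).mpr h'⟩⟩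
  rw [h2]
  have hK : 0 < Nat.card K := Nat.card_pos
  apply Nat.eq_of_mul_eq_mul_right hK
  rw [mul_right_comm, h1, mul_right_comm, hA, ← Nat.card_coe_set_eq, mul_comm]
  rfl

/-- Among the vectors of `P` that are not orthogonal to `U`, one in `F.index` is singular, because
this holds in every coset of `U`. -/
theorem ncard_isSingular_diff_perp {F : ClassicalForm K V} {U P : Submodule K V}
    (hU : F.IsSubspace U) (hUP : U ≤ P) :
    {x ∈ (P : Set V) | x ∉ F.perp U ∧ F.IsSingular x}.ncard * F.index =
      {x ∈ (P : Set V) | x ∉ F.perp U}.ncard := by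
  have := Module.finite_of_finite K (M := V)
  have hUU := (isSubspace_iff.mp hU).2
  have hpos : 0 < (U : Set V).ncard := (Set.ncard_pos).mpr ⟨0, U.zero_mem⟩
  have hs := F.index_pos
  rcases Set.eq_empty_or_nonempty {x ∈ (P : Set V) | x ∉ F.perp U} with h0 | ⟨x₀, hx₀⟩
  · rw [h0, Set.ncard_empty, mul_eq_zero]
    left
    rw [Set.ncard_eq_zero, Set.eq_empty_iff_forall_notMem] at *
    exact fun x hx => h0 x ⟨hx.1, hx.2.1⟩
  set m := {u ∈ (U : Set V) | F.IsSingular (x₀ + u)}.ncard with hm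
  have hms : m * F.index = (U : Set V).ncard := ncard_coset hU hx₀.2
  have h := ncard_mul_eq_ncard_mul {x ∈ (P : Set V) | x ∉ F.perp U}
    {x ∈ (P : Set V) | x ∉ F.perp U ∧ F.IsSingular x} (fun x y => y - x ∈ U) m
    (U : Set V).ncard ?_ ?_
  · apply Nat.eq_of_mul_eq_mul_right hpos
    rw [mul_right_comm, ← h, mul_assoc, hms]
  · rintro x ⟨hxP, hxU⟩
    apply Nat.eq_of_mul_eq_mul_right hs
    rw [hms, ← ncard_coset hU hxU]
    congr 1
    symm
    refine Set.ncard_congr (fun u _ => x + u) ?_ ?_ ?_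
    · rintro u ⟨hu, hsing⟩
      refine ⟨⟨P.add_mem hxP (hUP hu), ?_, hsing⟩, by simpa using hu⟩
      rwa [Submodule.add_mem_iff_left _ (hUU hu)]
    · intro a b _ _ h
      simpa using h
    · rintro y ⟨⟨hyP, hyU, hsing⟩, hyx⟩
      exact ⟨y - x, ⟨hyx, by simpa using hsing⟩, by simp⟩
  · rintro y ⟨hyP, hyU, -⟩
    symm
    refine Set.ncard_congr (fun u _ => y - u) ?_ ?_ ?_
    · intro u hu
      refine ⟨⟨P.sub_mem hyP (hUP hu), ?_⟩, by simpa using hu⟩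
      rwa [Submodule.sub_mem_iff_left _ (hUU hu)]
    · intro a b _ _ h
      simpa using h
    · rintro x ⟨-, hx⟩
      exact ⟨y - x, hx, by simp⟩

/-- The number `N` of singular vectors orthogonal to an `m`-dimensional subspace `T` of the polar
space satisfies `s N = q ^ (n - m) - q ^ (n - r) + s q ^ r`. For a maximal subspace `U` containing
`T`, the singular vectors of `U^⊥` are those of `U`, and those of `T^⊥ ∖ U^⊥` are counted by
cosets of `U`. -/
theorem ncard_isSingular_perp {F : ClassicalForm K V} (hF : F.Nondegenerate) {r : ℕ}
    (hr : F.HasRank r) {T : Submodule K V} (hT : F.IsSubspace T) :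
    {x | x ∈ F.perp T ∧ F.IsSingular x}.ncard * F.index +
        Nat.card K ^ (Module.finrank K V - r) =
      Nat.card K ^ (Module.finrank K V - Module.finrank K T) + Nat.card K ^ r * F.index := by
  have := Module.finite_of_finite K (M := V)
  obtain ⟨W, hW, hWr⟩ := hr.1
  obtain ⟨U, hU, hTU, hUW⟩ := exists_le_finrank_eq hF hT hW (hWr ▸ hr.2 ⟨T, hT, rfl⟩)
  have hUr := hUW.trans hWr
  have hUU := (isSubspace_iff.mp hU).2
  have hUT := F.perp_anti hTU
  have h1 := ncard_isSingular_diff_perp hU (hUU.trans hUT)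
  have h2 : {x | x ∈ F.perp T ∧ F.IsSingular x} =
      {x ∈ (F.perp T : Set V) | x ∉ F.perp U ∧ F.IsSingular x} ∪ U := by
    ext x
    constructor
    · rintro ⟨hx, hsing⟩
      by_cases hxU : x ∈ F.perp U
      · exact Or.inr (mem_of_isSingular_of_mem_perp hr hU hUr hsing hxU)
      · exact Or.inl ⟨hx, hxU, hsing⟩
    · rintro (⟨hx, -, hsing⟩ | hx)
      · exact ⟨hx, hsing⟩
      · exact ⟨hUT (hUU hx), (isSubspace_iff.mp hU).1 x hx⟩
  have h3 : Disjoint {x ∈ (F.perp T : Set V) | x ∉ F.perp U ∧ F.IsSingular x} (U : Set V) := by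
    rw [Set.disjoint_left]
    exact fun x hx hxU => hx.2.1 (hUU hxU)
  have h4 : {x ∈ (F.perp T : Set V) | x ∉ F.perp U}.ncard + (F.perp U : Set V).ncard =
      (F.perp T : Set V).ncard :=
    Set.ncard_sdiff_add_ncard_of_subset hUT
  have h5 := finrank_perp hF hU
  have h6 := finrank_perp hF hT
  rw [h2, Set.ncard_union_eq h3, add_mul, h1, ncard_submodule U, hUr]
  rw [ncard_submodule, ncard_submodule] at h4
  rw [show Module.finrank K V - r = Module.finrank K (F.perp U) by omega,
    show Module.finrank K V - Module.finrank K T = Module.finrank K (F.perp T) by omega, ← h4]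
  ring

end ClassicalForm

namespace ClassicalForm

/-! ### Restriction to a hyperplane -/

theorem isSingular_restrict {F : ClassicalForm K V} {H : Submodule K V} {x : H} :
    (F.restrict H).IsSingular x ↔ F.IsSingular (x : V) := by
  cases F <;> rfl

theorem sesq_restrict {F : ClassicalForm K V} {H : Submodule K V} (x y : H) :
    (F.restrict H).sesq x y = F.sesq (x : V) y := by
  cases F <;> rfl

theorem mem_perp_restrict {F : ClassicalForm K V} {H : Submodule K V} {U : Submodule K H}
    {x : H} : x ∈ (F.restrict H).perp U ↔ (x : V) ∈ F.perp (U.map H.subtype) := by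
  rw [mem_perp, mem_perp]
  constructor
  · rintro h _ ⟨y, hy, rfl⟩
    exact (sesq_restrict y x).symm.trans (h y hy)
  · exact fun h y hy => (sesq_restrict y x).trans (h y ⟨y, hy, rfl⟩)

theorem isSubspace_restrict {F : ClassicalForm K V} {H : Submodule K V} {U : Submodule K H} :
    (F.restrict H).IsSubspace U ↔ F.IsSubspace (U.map H.subtype) := by
  rw [isSubspace_iff, isSubspace_iff]
  refine and_congr ⟨?_, fun h x hx => isSingular_restrict.mpr (h x ⟨x, hx, rfl⟩)⟩
    ⟨?_, fun h x hx => mem_perp_restrict.mpr (h ⟨x, hx, rfl⟩)⟩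
  · rintro h _ ⟨x, hx, rfl⟩
    exact isSingular_restrict.mp (h x hx)
  · rintro h _ ⟨x, hx, rfl⟩
    exact mem_perp_restrict.mp (h hx)

theorem index_restrict (F : ClassicalForm K V) (H : Submodule K V) :
    (F.restrict H).index = F.index := by
  cases F <;> rfl

theorem finrank_map_subtype (H : Submodule K V) (U : Submodule K H) :
    Module.finrank K (U.map H.subtype) = Module.finrank K U :=
  LinearEquiv.finrank_eq (Submodule.equivMapOfInjective _ H.injective_subtype U).symm

theorem exists_hasRank [FiniteDimensional K V] (F : ClassicalForm K V) : ∃ r, F.HasRank r := by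
  have hb : BddAbove {d | ∃ U : Submodule K V, F.IsSubspace U ∧ Module.finrank K U = d} :=
    ⟨Module.finrank K V, by rintro _ ⟨U, -, rfl⟩; exact U.finrank_le⟩
  exact ⟨_, Nat.sSup_mem ⟨_, ⊥, F.isSubspace_bot, rfl⟩ hb, fun _ hd => le_csSup hb hd⟩

theorem finrank_le_finrank_inf_add_one [FiniteDimensional K V] {H : Submodule K V}
    (hH : Module.finrank K H + 1 = Module.finrank K V) (U : Submodule K V) :
    Module.finrank K U ≤ Module.finrank K ↥(U ⊓ H) + 1 := by
  have h1 := Submodule.finrank_sup_add_finrank_inf_eq U H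
  have h2 := Submodule.finrank_le (U ⊔ H)
  omega

theorem HasRank.restrict [FiniteDimensional K V] {F : ClassicalForm K V} {r r' : ℕ}
    (hr : F.HasRank r) {H : Submodule K V}
    (hH : Module.finrank K H + 1 = Module.finrank K V)
    (hr' : (F.restrict H).HasRank r') : r' = r ∨ r' = r - 1 := by
  have h1 : r' ≤ r := by
    obtain ⟨U, hU, rfl⟩ := hr'.1
    exact hr.2 ⟨_, isSubspace_restrict.mp hU, finrank_map_subtype H U⟩
  obtain ⟨U, hU, rfl⟩ := hr.1
  have h2 := finrank_le_finrank_inf_add_one hH U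
  have h3 : (U.comap H.subtype).map H.subtype = U ⊓ H := by
    rw [Submodule.map_comap_subtype, inf_comm]
  have h4 := hr'.2 ⟨U.comap H.subtype,
    isSubspace_restrict.mpr (h3 ▸ hU.mono inf_le_left), rfl⟩
  rw [← h3, finrank_map_subtype] at h2
  omega

/-! ### Dimension of the ambient space of a polar space of given rank -/

/-- A quadratic form in at least three variables over a finite field has a nontrivial zero, by the
Chevalley–Warning theorem. -/
theorem exists_ne_zero_quadratic_eq_zero [Finite K] [FiniteDimensional K V]
    (f : QuadraticForm K V) (h : 3 ≤ Module.finrank K V) : ∃ x, x ≠ 0 ∧ f x = 0 := by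
  classical
  have := Fintype.ofFinite K
  obtain ⟨p, hp⟩ := CharP.exists K
  obtain ⟨B, rfl⟩ := LinearMap.BilinMap.toQuadraticMap_surjective (R := K) f
  let b := Module.finBasis K V
  let P : MvPolynomial (Fin (Module.finrank K V)) K :=
    ∑ i, ∑ j, MvPolynomial.C (B (b i) (b j)) * (MvPolynomial.X i * MvPolynomial.X j)
  have hdeg : P.totalDegree < Fintype.card (Fin (Module.finrank K V)) := by
    rw [Fintype.card_fin]
    refine lt_of_le_of_lt ?_ h
    refine MvPolynomial.totalDegree_finsetSum_le fun i _ =>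
      MvPolynomial.totalDegree_finsetSum_le fun j _ => ?_
    refine (MvPolynomial.totalDegree_mul _ _).trans ?_
    rw [MvPolynomial.totalDegree_C, zero_add]
    refine (MvPolynomial.totalDegree_mul _ _).trans ?_
    simp
  have heval : ∀ c, MvPolynomial.eval c P = B (∑ i, c i • b i) (∑ i, c i • b i) := by
    intro c
    simp only [P, map_sum, map_mul, MvPolynomial.eval_C, MvPolynomial.eval_X, map_smul,
      LinearMap.sum_apply, LinearMap.smul_apply, smul_eq_mul, Finset.mul_sum]
    rw [Finset.sum_comm]
    refine Finset.sum_congr rfl fun i _ => Finset.sum_congr rfl fun j _ => by ring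
  have hdvd := char_dvd_card_solutions (K := K) p hdeg
  by_contra! hcon
  have hp1 := (CharP.char_is_prime K p).one_lt
  have hone : Fintype.card {c // MvPolynomial.eval c P = 0} = 1 := by
    rw [Fintype.card_eq_one_iff]
    refine ⟨⟨0, by rw [heval]; simp⟩, fun c => Subtype.ext ?_⟩
    by_contra hc
    refine hcon (∑ i, c.1 i • b i) (fun h0 => hc ?_) ?_
    · exact funext fun i => Fintype.linearIndependent_iff.mp b.linearIndependent _ h0 i
    · rw [LinearMap.BilinMap.toQuadraticMap_apply, ← heval, c.2]
  rw [hone, Nat.dvd_one] at hdvd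
  omega

/-- A Hermitian form in at least two variables over a finite field has a nontrivial zero: adjust
one of two orthogonal vectors by an element of suitable norm. -/
theorem exists_ne_zero_hermitian_eq_zero [Finite K] {σ : K →+* K} (invol : ∀ a, σ (σ a) = a)
    (hσ : σ ≠ RingHom.id K) (h : V →ₛₗ[σ] V →ₗ[K] K) (symm : ∀ x y, σ (h x y) = h y x)
    {C : Submodule K V} (hC : 2 ≤ Module.finrank K C) : ∃ x ∈ C, x ≠ 0 ∧ h x x = 0 := by
  by_contra! hcon
  have hCf : FiniteDimensional K C := FiniteDimensional.of_finrank_pos (by omega)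
  obtain ⟨x, hxC, hx0⟩ : ∃ x ∈ C, x ≠ 0 := by
    apply Submodule.exists_mem_ne_zero_of_ne_bot
    rintro rfl
    simp at hC
  obtain ⟨y, hyC, hyx⟩ : ∃ y ∈ C, y ∉ Submodule.span K {x} := by
    by_contra! hle
    have h1 : Module.finrank K C ≤ Module.finrank K (Submodule.span K {x}) :=
      Submodule.finrank_mono hle
    rw [finrank_span_singleton hx0] at h1
    omega
  have hxx := hcon x hxC hx0
  set z := y - (h x y / h x x) • x with hz
  have hxz : h x z = 0 := by
    simp only [hz, map_sub, map_smul, smul_eq_mul]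
    field_simp
    ring
  have hzx : h z x = 0 := by rw [← symm, hxz, map_zero]
  have hxs : Submodule.span K {x} ≤ C := (Submodule.span_singleton_le_iff_mem x C).mpr hxC
  have hxm := Submodule.mem_span_singleton_self (R := K) x
  have hzC : z ∈ C := C.sub_mem hyC (C.smul_mem _ hxC)
  have hzs : z ∉ Submodule.span K {x} := by
    rwa [hz, Submodule.sub_mem_iff_left _ (Submodule.smul_mem _ _ hxm)]
  have hzz := hcon z hzC (fun h0 => hzs (h0 ▸ Submodule.zero_mem _))
  obtain ⟨a, ha⟩ := exists_mul_conj_eq invol hσ (c := - h z z / h x x)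
    (by simp [symm]) (div_ne_zero (neg_ne_zero.mpr hzz) hxx)
  refine hcon (z + a • x) (C.add_mem hzC (C.smul_mem _ hxC)) ?_ ?_
  · intro h0
    apply hzs
    rw [eq_neg_of_add_eq_zero_left h0]
    exact Submodule.neg_mem _ (Submodule.smul_mem _ _ hxm)
  · simp only [map_add, LinearMap.add_apply, map_smulₛₗ, LinearMap.smul_apply, hzx, hxz,
      smul_eq_mul]
    have ha' : σ a * (a * h x x) = - h z z := by
      rw [← mul_assoc, mul_comm (σ a), ha]
      field_simp
    linear_combination ha'

/-- The number `q ^ (r + ε)`, which occurs in the order of the polar space, in terms of the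
dimension of the ambient space. -/
theorem HasType.index_mul_rpow [Finite K] {F : ClassicalForm K V} {Q : PolarType} {r : ℕ}
    (h : F.HasType Q r) :
    (F.index : ℝ) * (Nat.card K : ℝ) ^ ((r : ℝ) + Q.eps) =
      (Nat.card K : ℝ) ^ (Module.finrank K V - r) := by
  have hq : (0 : ℝ) < Nat.card K := by exact_mod_cast Nat.card_pos
  have hherm : ∀ (σ : K →+* K), (∀ a, σ (σ a) = a) → σ ≠ RingHom.id K →
      (({a | σ a = a}.ncard : ℕ) : ℝ) = (Nat.card K : ℝ) ^ (1 / 2 : ℝ) := by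
    intro σ invol nontriv
    rw [← Real.sqrt_eq_rpow, eq_comm, Real.sqrt_eq_iff_mul_self_eq hq.le (by positivity)]
    exact_mod_cast (ncard_fixed_sq invol nontriv).symm
  cases F with
  | alternating B alt =>
    cases Q <;> try exact h.elim
    have h : Module.finrank K V = 2 * r := h
    rw [h, show 2 * r - r = r by omega]
    simp [index, PolarType.eps]
  | hermitian σ invol nontriv b symm =>
    cases Q <;> try exact h.elim
    · have h : Module.finrank K V = 2 * r := h
      rw [h, show 2 * r - r = r by omega, index, hherm σ invol nontriv, ← Real.rpow_add hq,
        ← Real.rpow_natCast]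
      congr 1
      simp only [PolarType.eps]
      ring
    · have h : Module.finrank K V = 2 * r + 1 := h
      rw [h, show 2 * r + 1 - r = r + 1 by omega, index, hherm σ invol nontriv,
        ← Real.rpow_add hq, ← Real.rpow_natCast]
      congr 1
      simp only [PolarType.eps]
      push_cast
      ring
  | quadratic f =>
    have hmul : ∀ x : ℝ, (Nat.card K : ℝ) * (Nat.card K : ℝ) ^ x = (Nat.card K : ℝ) ^ (1 + x) := by
      intro x
      rw [Real.rpow_add hq, Real.rpow_one]
    cases Q <;> try exact h.elim
    · have h : Module.finrank K V = 2 * r := h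
      rw [h, show 2 * r - r = r by omega, index, hmul, ← Real.rpow_natCast]
      congr 1
      simp [PolarType.eps]
    · have h : Module.finrank K V = 2 * r + 1 := h
      rw [h, show 2 * r + 1 - r = r + 1 by omega, index, hmul, ← Real.rpow_natCast]
      congr 1
      simp only [PolarType.eps]
      push_cast
      ring
    · have h : Module.finrank K V = 2 * r + 2 := h
      rw [h, show 2 * r + 2 - r = r + 2 by omega, index, hmul, ← Real.rpow_natCast]
      congr 1
      simp only [PolarType.eps]
      push_cast
      ring

variable [Finite K] [FiniteDimensional K V]

/-- A complement of a maximal subspace `U` of the polar space in `U^⊥` is anisotropic. -/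
theorem exists_anisotropic {F : ClassicalForm K V} (hF : F.Nondegenerate) {r : ℕ}
    (hr : F.HasRank r) : ∃ C : Submodule K V, Module.finrank K V ≤ 2 * r + Module.finrank K C ∧
      ∀ x ∈ C, F.IsSingular x → x = 0 := by
  obtain ⟨U, hU, hUr⟩ := hr.1
  obtain ⟨C, hC⟩ := Submodule.exists_isCompl U
  refine ⟨C ⊓ F.perp U, ?_, ?_⟩
  · have h1 := Submodule.finrank_sup_add_finrank_inf_eq C (F.perp U)
    have h2 := Submodule.finrank_le (C ⊔ F.perp U)
    have h3 := Submodule.finrank_add_eq_of_isCompl hC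
    have h4 := finrank_perp hF hU
    omega
  · intro x hx hsing
    have hxU := mem_of_isSingular_of_mem_perp hr hU hUr hsing hx.2
    exact (Submodule.disjoint_def.mp hC.disjoint) x hxU hx.1

/-- A non-degenerate form of rank `r` is of one of the six types. -/
theorem exists_isPolarSpace {F : ClassicalForm K V} (hF : F.Nondegenerate) {r : ℕ}
    (hr : F.HasRank r) : ∃ Q, F.IsPolarSpace Q r := by
  obtain ⟨C, hC, hCa⟩ := exists_anisotropic hF hr
  have hle : 2 * r ≤ Module.finrank K V := by
    obtain ⟨U, hU, rfl⟩ := hr.1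
    exact two_mul_finrank_le hF hU
  suffices ∃ Q, F.HasType Q r from this.imp fun Q hQ => ⟨hF, hr, hQ⟩
  cases F with
  | alternating B alt =>
    have hC0 : C = ⊥ := (Submodule.eq_bot_iff C).mpr fun x hx => hCa x hx trivial
    subst hC0
    rw [finrank_bot] at hC
    exact ⟨.symplectic, show _ = _ by omega⟩
  | hermitian σ invol nontriv h symm =>
    have hC1 : Module.finrank K C < 2 := by
      by_contra! hge
      obtain ⟨x, hx, hx0, hxx⟩ := exists_ne_zero_hermitian_eq_zero invol nontriv h symm hge
      exact hx0 (hCa x hx hxx)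
    by_cases hn : Module.finrank K V = 2 * r
    · exact ⟨.hermitianPlus, hn⟩
    · exact ⟨.hermitianMinus, show _ = _ by omega⟩
  | quadratic f =>
    have hC1 : Module.finrank K C < 3 := by
      by_contra! hge
      obtain ⟨x, hx0, hxx⟩ := exists_ne_zero_quadratic_eq_zero (f.comp C.subtype) hge
      exact hx0 (Subtype.ext (hCa x x.2 hxx))
    by_cases hn : Module.finrank K V = 2 * r
    · exact ⟨.hyperbolic, hn⟩
    · by_cases hn' : Module.finrank K V = 2 * r + 1
      · exact ⟨.parabolic, hn'⟩
      · exact ⟨.elliptic, show _ = _ by omega⟩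

end ClassicalForm

namespace ClassicalForm

/-! ### Blocks through a subspace of a hyperplane -/

theorem exists_isSubspace_finrank_eq [FiniteDimensional K V] {F : ClassicalForm K V} {r m : ℕ}
    (hr : F.HasRank r) (hm : m ≤ r) : ∃ T, F.IsSubspace T ∧ Module.finrank K T = m := by
  obtain ⟨U, hU, rfl⟩ := hr.1
  obtain ⟨f, hf⟩ := exists_linearIndependent_of_le_finrank hm
  refine ⟨(Submodule.span K (Set.range f)).map U.subtype,
    hU.mono (Submodule.map_subtype_le U _), ?_⟩
  rw [finrank_map_subtype, finrank_span_eq_card hf, Fintype.card_fin]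

theorem ncard_residual (D : Set (Submodule K V)) (H : Submodule K V) (T : Submodule K H) :
    {B ∈ residual D H | T ≤ B}.ncard = {B ∈ D | T.map H.subtype ≤ B ∧ B ≤ H}.ncard := by
  refine Set.ncard_congr (fun B _ => B.map H.subtype) ?_ ?_ ?_
  · rintro B ⟨hB, hTB⟩
    exact ⟨hB, Submodule.map_mono hTB, Submodule.map_subtype_le H B⟩
  · intro A B _ _ h
    exact Submodule.map_injective_of_injective H.injective_subtype h
  · rintro B ⟨hB, hTB, hBH⟩
    have h : (B.comap H.subtype).map H.subtype = B := by
      rw [Submodule.map_comap_subtype, inf_eq_right.mpr hBH]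
    refine ⟨B.comap H.subtype, ⟨?_, ?_⟩, h⟩
    · change Submodule.map _ _ ∈ D
      rwa [h]
    · exact Submodule.map_le_iff_le_comap.mp hTB

variable [Finite K] [FiniteDimensional K V]

/-- Double counting of the pairs of a singular vector `x` and a block `B` with `x ∈ B ∖ W` and
`T ≤ B`, where `dim T = t - 1`: such a vector extends `T` to a `t`-dimensional subspace of the
polar space. -/
theorem IsDesign.ncard_isSingular_mul {F : ClassicalForm K V} {Q : PolarType} {t r k l j : ℕ}
    {D : Set (Submodule K V)} (hD : F.IsDesign Q t r k l D) {T W : Submodule K V}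
    (hT : F.IsSubspace T) (hTt : Module.finrank K T + 1 = t) (hTW : T ≤ W)
    (hW : ∀ B ∈ D, T ≤ B → ¬ B ≤ W → Module.finrank K ↥(B ⊓ W) = j) :
    {x | x ∈ F.perp T ∧ F.IsSingular x ∧ x ∉ W}.ncard * l =
      {B ∈ D | T ≤ B ∧ ¬ B ≤ W}.ncard * (Nat.card K ^ k - Nat.card K ^ j) := by
  have := Module.finite_of_finite K (M := V)
  refine ncard_mul_eq_ncard_mul _ _ (fun x B => x ∈ B) _ _ ?_ ?_
  · rintro x ⟨hx, hsing, hxW⟩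
    rw [← hD.regular _ (hT.sup_span hsing hx) ((finrank_sup_span fun h => hxW (hTW h)).trans hTt)]
    congr 1
    ext B
    constructor
    · rintro ⟨⟨hB, hTB, -⟩, hxB⟩
      exact ⟨hB, sup_le hTB ((Submodule.span_singleton_le_iff_mem x B).mpr hxB)⟩
    · rintro ⟨hB, hle⟩
      have hxB := (Submodule.span_singleton_le_iff_mem x B).mp (le_sup_right.trans hle)
      exact ⟨⟨hB, le_sup_left.trans hle, fun h => hxW (h hxB)⟩, hxB⟩
  · rintro B ⟨hB, hTB, hBW⟩
    have hsub := isSubspace_iff.mp (hD.blocks B hB).1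
    have h1 : {x ∈ {x | x ∈ F.perp T ∧ F.IsSingular x ∧ x ∉ W} | x ∈ B} =
        (B : Set V) \ ((B ⊓ W : Submodule K V) : Set V) := by
      ext x
      constructor
      · rintro ⟨⟨-, -, hxW⟩, hxB⟩
        exact ⟨hxB, fun h => hxW h.2⟩
      · rintro ⟨hxB, hx⟩
        exact ⟨⟨F.perp_anti hTB (hsub.2 hxB), hsub.1 x hxB, fun h => hx ⟨hxB, h⟩⟩, hxB⟩
    rw [h1, Set.ncard_sdiff (fun x hx => hx.1), ncard_submodule, ncard_submodule, hW B hB hTB hBW,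
      (hD.blocks B hB).2]

/-- The number of blocks through `T` in the hyperplane `H`, as a real number depending only on the
parameters. -/
noncomputable def residualIndex (q t r k l r' : ℕ) (ε : ℝ) : ℝ :=
  if r' = r then
    (qNumber q (r - t + 1) : ℝ) * ((q : ℝ) ^ ((r : ℝ) - (k : ℝ) + ε) + 1) /
      (qNumber q (k - t + 1) : ℝ) * (l : ℝ)
  else
    ((q : ℝ) ^ ((r : ℝ) - (t : ℝ) + 1 + ε) + 1) * (qNumber q (r - k) : ℝ) /
      (qNumber q (k - t + 1) : ℝ) * (l : ℝ)

theorem cast_qNumber {q : ℕ} (hq : 1 < q) (m : ℕ) :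
    (qNumber q m : ℝ) = ((q : ℝ) ^ m - 1) / ((q : ℝ) - 1) := by
  have : (q : ℝ) ≠ 1 := by exact_mod_cast hq.ne'
  rw [qNumber, Nat.cast_sum, ← geom_sum_eq this]
  simp

/-- The elimination that gives the number `a` of blocks inside the hyperplane, if `N` and `N'` are
the numbers of singular vectors orthogonal to `T` in the whole space and in the hyperplane, and
`c` is the number of remaining blocks. -/
theorem eq_residualIndex {q t r k l r' : ℕ} {ε s n N N' a c : ℝ} (hq : 1 < q) (ht : 1 ≤ t)
    (htk : t ≤ k) (hkr : k ≤ r) (hr' : r' = r ∨ r' = r - 1) (hs : 0 < s)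
    (hE : s * (q : ℝ) ^ ((r : ℝ) + ε) = n) {n' : ℝ}
    (hn' : n' * (q : ℝ) ^ (r' + 1) = n * (q : ℝ) ^ r)
    (hN : N * s + n = n * (q : ℝ) ^ (r - t + 1) + (q : ℝ) ^ r * s)
    (hN' : N' * s + n' = n * (q : ℝ) ^ (r - t) + (q : ℝ) ^ r' * s)
    (h1 : (N - (q : ℝ) ^ (t - 1)) * l = (a + c) * ((q : ℝ) ^ k - (q : ℝ) ^ (t - 1)))
    (h2 : (N - N') * l = c * ((q : ℝ) ^ k - (q : ℝ) ^ (k - 1))) :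
    a = residualIndex q t r k l r' ε := by
  have hq1 : (1 : ℝ) < q := by exact_mod_cast hq
  have hq0 : (0 : ℝ) < q := by linarith
  obtain ⟨t, rfl⟩ : ∃ t', t = t' + 1 := ⟨t - 1, by omega⟩
  obtain ⟨d, rfl⟩ := Nat.exists_eq_add_of_le htk
  obtain ⟨e, rfl⟩ := Nat.exists_eq_add_of_le hkr
  set E := (q : ℝ) ^ (((t + 1 + d + e : ℕ) : ℝ) + ε) with hEdef
  rw [show t + 1 + d + e - (t + 1) + 1 = d + 1 + e by omega, pow_add, pow_add] at hN
  rw [show t + 1 + d + e - (t + 1) = d + e by omega, pow_add] at hN'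
  rw [show t + 1 - 1 = t by omega, show t + 1 + d = t + (d + 1) by omega, pow_add,
    pow_add] at h1
  rw [show t + 1 + d - 1 = t + d by omega, show t + 1 + d = t + (d + 1) by omega, pow_add,
    pow_add, pow_add] at h2
  have hX : (q : ℝ) ^ (((t + 1 + d + e : ℕ) : ℝ) - ((t + 1 + d : ℕ) : ℝ) + ε) =
      E / (q : ℝ) ^ (t + 1 + d) := by
    rw [hEdef, ← Real.rpow_natCast, ← Real.rpow_sub hq0]
    congr 1
    ring
  have hY : (q : ℝ) ^ (((t + 1 + d + e : ℕ) : ℝ) - ((t + 1 : ℕ) : ℝ) + 1 + ε) =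
      E / (q : ℝ) ^ t := by
    rw [hEdef, ← Real.rpow_natCast, ← Real.rpow_sub hq0]
    congr 1
    push_cast
    ring
  have hd1 : (1 : ℝ) < (q : ℝ) ^ (d + 1) := one_lt_pow₀ hq1 (by omega)
  have hd : (q : ℝ) ^ (d + 1) - 1 ≠ 0 := by linarith
  have hq1' : (q : ℝ) - 1 ≠ 0 := by linarith
  have hN2 : N = E * ((q : ℝ) ^ d * q * q ^ e) + (q : ℝ) ^ (t + 1 + d + e) - E := by
    apply mul_right_cancel₀ hs.ne'
    subst hE
    linear_combination hN
  have ht0 : (q : ℝ) ^ t ≠ 0 := by positivity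
  have hd0 : (q : ℝ) ^ d ≠ 0 := by positivity
  unfold residualIndex
  rw [cast_qNumber hq, cast_qNumber hq, cast_qNumber hq, hX, hY,
    show t + 1 + d + e - (t + 1) + 1 = d + 1 + e by omega,
    show t + 1 + d - (t + 1) + 1 = d + 1 by omega, show t + 1 + d + e - (t + 1 + d) = e by omega]
  have ha : a = (N - (q : ℝ) ^ t) * l / ((q : ℝ) ^ t * ((q : ℝ) ^ (d + 1) - 1)) - c := by
    field_simp
    linear_combination -h1
  have hc : c = (N - N') * l * q / ((q : ℝ) ^ t * (q : ℝ) ^ (d + 1) * (q - 1)) := by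
    field_simp
    linear_combination (-q : ℝ) * h2
  split_ifs with hrr
  · subst hrr
    have hn2 : n' = n / q := by
      rw [eq_div_iff hq0.ne']
      apply mul_right_cancel₀ (pow_ne_zero (t + 1 + d + e) hq0.ne')
      linear_combination hn'
    have hN3 : N' = E * ((q : ℝ) ^ d * q ^ e) + (q : ℝ) ^ (t + 1 + d + e) - E / q := by
      apply mul_right_cancel₀ hs.ne'
      subst hE
      rw [hn2] at hN'
      linear_combination hN'
    rw [ha, hc, hN2, hN3]
    field_simp
    ring
  · have hrr' : r' = t + d + e := by omega
    subst hrr'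
    have hn2 : n' = n := by
      apply mul_right_cancel₀ (pow_ne_zero (t + 1 + d + e) hq0.ne')
      rw [← hn']
      congr 2
      ring
    have hN3 : N' = E * ((q : ℝ) ^ d * q ^ e) + (q : ℝ) ^ (t + d + e) - E := by
      apply mul_right_cancel₀ hs.ne'
      subst hE
      rw [hn2] at hN'
      linear_combination hN'
    rw [ha, hc, hN2, hN3]
    field_simp
    ring

/-- The number of blocks through `T` in the hyperplane depends only on the parameters. The blocks
through `T`, and those of them that are not in the hyperplane, are counted by the singular vectors
that they contain outside `T` and outside the hyperplane. -/
theorem IsDesign.cast_ncard_residual {F : ClassicalForm K V} {Q : PolarType} {t r k l r' : ℕ}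
    {D : Set (Submodule K V)} (hD : F.IsDesign Q t r k l D) (ht : 1 ≤ t) (htk : t ≤ k)
    (hkr : k ≤ r) {H : Submodule K V} (hH : F.IsNondegenerateHyperplane H)
    (hr' : (F.restrict H).HasRank r') {T : Submodule K H} (hT : (F.restrict H).IsSubspace T)
    (hTt : Module.finrank K T = t - 1) :
    ({B ∈ residual D H | T ≤ B}.ncard : ℝ) = residualIndex (Nat.card K) t r k l r' Q.eps := by
  have := Module.finite_of_finite K (M := V)
  have hq : 1 < Nat.card K := Finite.one_lt_card
  rw [ncard_residual]
  set S := T.map H.subtype with hS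
  have hSS : F.IsSubspace S := isSubspace_restrict.mp hT
  have hSt : Module.finrank K S = t - 1 := (finrank_map_subtype H T).trans hTt
  have hSH : S ≤ H := Submodule.map_subtype_le H T
  have hF := hD.ambient.nondegenerate
  have hr := hD.ambient.rank
  have hrr := hr.restrict hH.hyperplane hr'
  have hdim := hH.hyperplane
  have h2r : 2 * r ≤ Module.finrank K V := by
    obtain ⟨U, hU, rfl⟩ := hr.1
    exact two_mul_finrank_le hF hU
  have h2r' : 2 * r' ≤ Module.finrank K H := by
    obtain ⟨U, hU, rfl⟩ := hr'.1
    exact two_mul_finrank_le hH.nondegenerate hU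
  -- Singular vectors orthogonal to `S`, in `V` and in `H`.
  have hN := ncard_isSingular_perp hF hr hSS
  have hN' := ncard_isSingular_perp hH.nondegenerate hr' hT
  rw [index_restrict, hTt] at hN'
  rw [hSt] at hN
  have hNH : {x | x ∈ (F.restrict H).perp T ∧ (F.restrict H).IsSingular x}.ncard =
      {x | (x ∈ F.perp S ∧ F.IsSingular x) ∧ x ∈ H}.ncard := by
    rw [← Set.ncard_image_of_injective _ H.injective_subtype]
    congr 1
    ext x
    constructor
    · rintro ⟨y, ⟨hy, hys⟩, rfl⟩
      exact ⟨⟨mem_perp_restrict.mp hy, isSingular_restrict.mp hys⟩, y.2⟩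
    · rintro ⟨⟨hx, hxs⟩, hxH⟩
      exact ⟨⟨x, hxH⟩, ⟨mem_perp_restrict.mpr hx, isSingular_restrict.mpr hxs⟩, rfl⟩
  rw [hNH] at hN'
  have hsplitS : {x | x ∈ F.perp S ∧ F.IsSingular x ∧ x ∉ S}.ncard + Nat.card K ^ (t - 1) =
      {x | x ∈ F.perp S ∧ F.IsSingular x}.ncard := by
    have h : (S : Set V) ⊆ {x | x ∈ F.perp S ∧ F.IsSingular x} := fun x hx =>
      ⟨(isSubspace_iff.mp hSS).2 hx, (isSubspace_iff.mp hSS).1 x hx⟩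
    rw [← hSt, ← ncard_submodule, ← Set.ncard_sdiff_add_ncard_of_subset h]
    congr 2
    ext x
    simp [and_assoc]
  have hsplitH : {x | x ∈ F.perp S ∧ F.IsSingular x ∧ x ∉ H}.ncard +
      {x | (x ∈ F.perp S ∧ F.IsSingular x) ∧ x ∈ H}.ncard =
      {x | x ∈ F.perp S ∧ F.IsSingular x}.ncard := by
    have h : {x | (x ∈ F.perp S ∧ F.IsSingular x) ∧ x ∈ H} ⊆
        {x | x ∈ F.perp S ∧ F.IsSingular x} := fun x hx => hx.1
    rw [← Set.ncard_sdiff_add_ncard_of_subset h]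
    congr 2
    ext x
    simp only [Set.mem_ofPred_eq, Set.mem_sdiff]
    tauto
  set N := {x | x ∈ F.perp S ∧ F.IsSingular x}.ncard
  set N' := {x | (x ∈ F.perp S ∧ F.IsSingular x) ∧ x ∈ H}.ncard
  -- The two double counts, with `W = S` and with `W = H`.
  have h1 := hD.ncard_isSingular_mul (j := t - 1) hSS (by omega) le_rfl
    (fun B _ hSB _ => by rw [inf_eq_right.mpr hSB, hSt])
  have h2 := hD.ncard_isSingular_mul (j := k - 1) hSS (by omega) hSH (fun B hB _ hBH => by
    have h3 := finrank_le_finrank_inf_add_one hdim B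
    have h4 := Submodule.finrank_lt_finrank_of_lt (inf_lt_left.mpr hBH)
    rw [(hD.blocks B hB).2] at h3 h4
    omega)
  have hblocks : {B ∈ D | S ≤ B ∧ ¬ B ≤ S}.ncard =
      {B ∈ D | S ≤ B ∧ B ≤ H}.ncard + {B ∈ D | S ≤ B ∧ ¬ B ≤ H}.ncard := by
    rw [← Set.ncard_union_eq]
    · congr 1
      ext B
      have hBS : B ∈ D → ¬ B ≤ S := fun hB hle => by
        have := Submodule.finrank_mono hle
        rw [(hD.blocks B hB).2] at this
        omega
      simp only [Set.mem_ofPred_eq, Set.mem_union]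
      tauto
    · rw [Set.disjoint_left]
      exact fun B hB hB' => hB'.2.2 hB.2.2
  rw [hblocks] at h1
  have hp1 : Nat.card K ^ (t - 1) ≤ Nat.card K ^ k := Nat.pow_le_pow_right hq.le (by omega)
  have hp2 : Nat.card K ^ (k - 1) ≤ Nat.card K ^ k := Nat.pow_le_pow_right hq.le (by omega)
  refine eq_residualIndex (N := N) (N' := N') (s := F.index)
    (c := {B ∈ D | S ≤ B ∧ ¬ B ≤ H}.ncard)
    (n' := (Nat.card K : ℝ) ^ (Module.finrank K H - r')) hq ht htk hkr hrr
    (by exact_mod_cast F.index_pos) hD.ambient.type.index_mul_rpow ?_ ?_ ?_ ?_ ?_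
  · rw [← pow_add, ← pow_add]
    congr 1
    omega
  · rw [← pow_add,
      show Module.finrank K V - r + (r - t + 1) = Module.finrank K V - (t - 1) by omega]
    exact_mod_cast hN
  · rw [← pow_add, show Module.finrank K V - r + (r - t) = Module.finrank K H - (t - 1) by omega]
    exact_mod_cast hN'
  · rw [← hsplitS]
    push_cast
    rw [add_sub_cancel_right]
    have := congrArg (Nat.cast (R := ℝ)) h1
    push_cast [Nat.cast_sub hp1] at this
    exact this
  · rw [← hsplitH]
    push_cast
    rw [add_sub_cancel_right]
    have := congrArg (Nat.cast (R := ℝ)) h2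
    push_cast [Nat.cast_sub hp2] at this
    exact this

end ClassicalForm

end PolarDesign

open PolarDesign PolarDesign.ClassicalForm in
theorem mainTheorem4 {K V : Type*} [Field K] [Finite K] [AddCommGroup V] [Module K V]
    [FiniteDimensional K V] (F : PolarDesign.ClassicalForm K V) (Q : PolarDesign.PolarType)
    (t r k l : ℕ) (ht : 1 ≤ t) (htk : t ≤ k) (hkr : k ≤ r)
    (D : Set (Submodule K V)) (hD : F.IsDesign Q t r k l D)
    (H : Submodule K V) (hH : F.IsNondegenerateHyperplane H) :
    ∃ (r' : ℕ) (Q' : PolarDesign.PolarType) (l' : ℕ),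
      (r' = r ∨ r' = r - 1) ∧
      (F.restrict H).IsDesign Q' (t - 1) r' k l' (PolarDesign.residual D H) ∧
      (r' = r → (l' : ℝ) =
        (PolarDesign.qNumber (Nat.card K) (r - t + 1) : ℝ) *
            ((Nat.card K : ℝ) ^ ((r : ℝ) - (k : ℝ) + Q.eps) + 1) /
          (PolarDesign.qNumber (Nat.card K) (k - t + 1) : ℝ) * (l : ℝ)) ∧
      (r' = r - 1 → (l' : ℝ) =
        ((Nat.card K : ℝ) ^ ((r : ℝ) - (t : ℝ) + 1 + Q.eps) + 1) *
            (PolarDesign.qNumber (Nat.card K) (r - k) : ℝ) /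
          (PolarDesign.qNumber (Nat.card K) (k - t + 1) : ℝ) * (l : ℝ)) := by
  obtain ⟨r', hr'⟩ := (F.restrict H).exists_hasRank
  obtain ⟨Q', hQ'⟩ := exists_isPolarSpace hH.nondegenerate hr'
  have hrr := hD.ambient.rank.restrict hH.hyperplane hr'
  obtain ⟨T₀, hT₀, hT₀t⟩ := exists_isSubspace_finrank_eq hr' (m := t - 1) (by omega)
  have key := fun T hT hTt =>
    hD.cast_ncard_residual ht htk hkr hH hr' (T := T) hT hTt
  refine ⟨r', Q', {B ∈ residual D H | T₀ ≤ B}.ncard, hrr, ⟨hQ', ?_, ?_⟩, ?_, ?_⟩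
  · intro B hB
    have h := hD.blocks _ hB
    exact ⟨isSubspace_restrict.mpr h.1, (finrank_map_subtype H B).symm.trans h.2⟩
  · intro T hT hTt
    exact_mod_cast (key T hT hTt).trans (key T₀ hT₀ hT₀t).symm
  · intro h
    rw [key T₀ hT₀ hT₀t, residualIndex, if_pos h]
  · intro h
    rw [key T₀ hT₀ hT₀t, residualIndex, if_neg (by omega)]
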